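/- On-line regression protocol: on each round $n=1,2,\dots$ Reality announces a signal $x_n\in\mathbb{R}/2\pi\mathbb{Z}$, Predictor announces a prediction $\mu_n\in\mathbb{R}$, and then Reality announces an observation $y_n\in[-1,1]$. For $h>0$ let $A_h$ be the class of real-valued functions on $\mathbb{R}/2\pi\mathbb{Z}$ (i.e. $2\pi$-periodic functions on $\mathbb{R}$) that have a bounded analytic continuation $f$ to the strip $|\operatorname{Im} z|<h$, with the norm $\|F\|_{A_h}=\sup_{|\operatorname{Im} z|<h}|f(z)|$. (When the strategy below is constructed for the class $A_H$, the closed strip $|\operatorname{Im} z|\le H$ may also be used instead of the open one.) The aggregating-algorithm (AA) mixture of countably many strategies $S_i$ with predictions in $[-1,1]$ and with positive weights $w_i$ summing to $1$ is the strategy that predicts on each round with $\sum_i w_ie^{-\ell_i/8}\gamma_i\big/\sum_i w_ie^{-\ell_i/8}$, where $\gamma_i$ is the current prediction of $S_i$ and $\ell_i$ is its total quadratic loss over the previous rounds. Strategy constructed for the class $A_H$: for all $i,j\ge1$ fix a $2^{-j}$-net $\mathcal{F}_{i,j}$ (in the uniform metric) of the smallest possible size for the ball $B_i=\{F\in A_H:\|F\|_{A_H}\le2^i\}$,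 with elements in $B_i$. For each $i$ let $S_i$ be the AA mixture of all the elements of all the nets $\mathcal{F}_{i,j}$, $j\ge1$ (as prediction rules, truncated to $[-1,1]$), where each element of $\mathcal{F}_{i,j}$ has the weight $\frac{6}{\pi^2}j^{-2}/|\mathcal{F}_{i,j}|$. The strategy is the AA mixture of $S_1,S_2,\dots$ with the weights $\frac{6}{\pi^2}i^{-2}$. There is a universal constant $C>0$ such that for each $H\in(0,\infty)$ such strategies exist and each of them guarantees the following. For each $h\in(0,H)$ and each $F\in A_h$ there is $N_0$ such that for all $N\ge N_0$ and all sequences of signals $x_n$ and observations $y_n\in[-1,1]$, $$\sum_{n=1}^N(y_n-\mu_n)^2\le\sum_{n=1}^N(y_n-F(x_n))^2+C\,\frac{H^2}{h^3}\log_2^2N .$$ -/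

import Mathlib

open Real

noncomputable section

namespace OnlineRegression

/-- The signal space: the circle `ℝ / 2πℤ`. Functions on it are the functions on the real line
that are periodic with period `2π`. -/
abbrev Signal : Type := AddCircle (2 * π)

instance : Fact ((0 : ℝ) < 2 * π) := ⟨Real.two_pi_pos⟩

/-! ### The classes of analytic functions -/

/-- The open strip `|Im z| < h`. -/
def openStrip (h : ℝ) : Set ℂ := {z | |z.im| < h}

/-- The closed strip `|Im z| ≤ h`. -/
def closedStrip (h : ℝ) : Set ℂ := {z | |z.im| ≤ h}

/-- `f` is an analytic continuation to `D ⊇ ℝ` of the real-valued `2π`-periodic function `F`.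
(Analyticity is required in a neighbourhood of each point of `D`.) -/
def IsContinuation (D : Set ℂ) (F : C(Signal, ℝ)) (f : ℂ → ℂ) : Prop :=
  AnalyticOnNhd ℂ f D ∧ ∀ t : ℝ, f (t : ℂ) = ((F (t : Signal) : ℝ) : ℂ)

/-- The class of the real-valued `2π`-periodic functions that have a bounded analytic
continuation to `D`. -/
def analyticClass (D : Set ℂ) : Set C(Signal, ℝ) :=
  {F | ∃ f : ℂ → ℂ, IsContinuation D F f ∧ ∃ R : ℝ, ∀ z ∈ D, ‖f z‖ ≤ R}

/-- The closed ball of radius `R` about `0` in `analyticClass D` for the norm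
`‖F‖ = sup_{z ∈ D} ‖f z‖`, where `f` is the analytic continuation of `F` (it is unique on `D`
when `D` is a strip). -/
def analyticBall (D : Set ℂ) (R : ℝ) : Set C(Signal, ℝ) :=
  {F | ∃ f : ℂ → ℂ, IsContinuation D F f ∧ ∀ z ∈ D, ‖f z‖ ≤ R}

/-! ### Nets -/

/-- `s` is a finite `ε`-net for `A`, with elements in `A`. -/
def IsNet {E : Type*} [PseudoMetricSpace E] (ε : ℝ) (A : Set E) (s : Finset E) : Prop :=
  (∀ g ∈ s, g ∈ A) ∧ ∀ f ∈ A, ∃ g ∈ s, dist f g ≤ ε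

/-- `s` is an `ε`-net for `A` of the least possible size, i.e. of size `2 ^ ℋ_ε(A)`,
where `ℋ_ε(A)` is the metric entropy of `A`. -/
def IsMinimalNet {E : Type*} [PseudoMetricSpace E] (ε : ℝ) (A : Set E) (s : Finset E) : Prop :=
  IsNet ε A s ∧ ∀ s' : Finset E, IsNet ε A s' → s.card ≤ s'.card

/-! ### Strategies -/

/-- A strategy for Predictor: given the signals and observations of the previous rounds
(the most recent round comes first) and the current signal, it outputs a prediction. -/
abbrev Strategy (X : Type*) : Type _ := List (X × ℝ) → X → ℝ

/-- The rounds before round `n` when Reality plays `x 0, y 0, x 1, y 1, …`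
(the most recent round comes first). -/
def history {X : Type*} (x : ℕ → X) (y : ℕ → ℝ) : ℕ → List (X × ℝ)
  | 0 => []
  | n + 1 => (x n, y n) :: history x y n

/-- The prediction of the strategy `S` on round `n` (rounds are numbered from `0`). -/
def Strategy.prediction {X : Type*} (S : Strategy X) (x : ℕ → X) (y : ℕ → ℝ) (n : ℕ) : ℝ :=
  S (history x y n) (x n)

/-- The total quadratic loss of the strategy `S` over the rounds in a history. -/
def Strategy.loss {X : Type*} (S : Strategy X) : List (X × ℝ) → ℝ
  | [] => 0
  | (x, y) :: t => Strategy.loss S t + (y - S t x) ^ 2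

/-- The prediction rule `F`, truncated to `[-1, 1]`, as a strategy. -/
def clippedRule {X : Type*} (F : X → ℝ) : Strategy X := fun _ x => max (-1) (min 1 (F x))

/-- The aggregating algorithm (for observations in `[-1, 1]`) applied to the strategies `S i` with
the initial weights `w i`: the weights are multiplied by `exp (-loss / 8)` and the prediction
is the weighted average of the predictions of the `S i`. -/
def aaMixture {X ι : Type*} (w : ι → ℝ) (S : ι → Strategy X) : Strategy X := fun t x =>
  (∑' i, w i * rexp (-(Strategy.loss (S i) t) / 8) * S i t x) /
    ∑' i, w i * rexp (-(Strategy.loss (S i) t) / 8)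

/-- The strategy for a compact benchmark class, built from `2 ^ (-j)`-nets `net (j - 1)` of this
class, `j = 1, 2, …`: the aggregating algorithm applied to all the elements of all the nets,
where each element of the `j`-th net has the weight `6 / π² * j⁻²` divided by the size of the net.
-/
def compactStrategy {X : Type*} [TopologicalSpace X] (net : ℕ → Finset C(X, ℝ)) : Strategy X :=
  aaMixture (ι := Σ j : ℕ, {g : C(X, ℝ) // g ∈ net j})
    (fun p => 6 / π ^ 2 * (((p.1 : ℝ) + 1) ^ 2)⁻¹ * ((net p.1).card : ℝ)⁻¹)
    (fun p => clippedRule (p.2 : C(X, ℝ)))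

/-- The strategy for a Banach benchmark class, built from nets for the balls of radius `2 ^ i`,
`i = 1, 2, …`: the aggregating algorithm applied to the strategies for these balls
with the weights `6 / π² * i⁻²`. -/
def banachStrategy {X : Type*} [TopologicalSpace X] (net : ℕ → ℕ → Finset C(X, ℝ)) : Strategy X :=
  aaMixture (fun i : ℕ => 6 / π ^ 2 * (((i : ℝ) + 1) ^ 2)⁻¹) (fun i => compactStrategy (net i))

/-- `net i j` is, for all `i` and `j`, a minimal `2 ^ (-(j + 1))`-net in the uniform metric for the
ball of radius `2 ^ (i + 1)` in `analyticClass D`. -/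
def IsNetSystem (D : Set ℂ) (net : ℕ → ℕ → Finset C(Signal, ℝ)) : Prop :=
  ∀ i j : ℕ, IsMinimalNet ((1 / 2 : ℝ) ^ (j + 1)) (analyticBall D (2 ^ (i + 1))) (net i j)

/-- `S` is a strategy constructed for the benchmark class `analyticClass D`. (The construction
leaves the choice of the minimal nets free.) -/
def IsStrategyFor (D : Set ℂ) (S : Strategy Signal) : Prop :=
  ∃ net : ℕ → ℕ → Finset C(Signal, ℝ), IsNetSystem D net ∧ S = banachStrategy net

end OnlineRegression

end

namespace OnlineRegression

/-! ### The aggregating algorithm -/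

/-! The function `exp (-u² / 8)` is concave on `[-2, 2]`, where all differences of observations and
predictions lie. Hence an AA mixture loses at most `8 log (1 / w i)` more than its `i`-th component
(`loss_aaMixture_le`). Applied to both layers, this gives a regret against an element of `net i j`
of at most 8 times the log of the size of that net, plus terms of order `log i + log j + 1`
(`loss_banachStrategy_le`).

A function `F` of `A_h` need not belong to `A_H`, so it is replaced by a partial sum of its Fourier
series. Shifting the contour of integration shows that the coefficients decay like `exp (-|n| h /
2)`, so degree `m ≈ 4 log N / h` gives uniform error `O(1 / N)`, that is, `O(1)` total extra loss
over `N` rounds. The partial sum is entire, and on the strip of half-width `H` it is bounded by `(2m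
+ 1) R exp (m H)`, eventually at most `N ^ (4H / h + 1)`. Thus `i ≈ (4H / h + 1) log₂ N` and `j ≈
log₂ N` suffice (`eventually_exists_dist_net_le`).

Rounding the Fourier coefficients of degree `O((p + q) / H)` shows that a minimal `2 ^ (-q)`-net of
the ball of radius `2 ^ p` has log-size `O((p + q)² / H)` (`eventually_entropy_le`). Here `p + q =
O((H / h) log₂ N)`, so the regret is `O((H / h²) log₂² N)`, which is even stronger than the claim
because `h < H`. -/

theorem hasDerivAt_exp_neg_sq (u : ℝ) :
    HasDerivAt (fun u : ℝ => rexp (-u ^ 2 / 8)) (-(u / 4) * rexp (-u ^ 2 / 8)) u := by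
  have h : HasDerivAt (fun u : ℝ => -u ^ 2 / 8) (-(u / 4)) u := by
    refine ((hasDerivAt_pow 2 u).fun_neg.div_const 8).congr_deriv ?_
    simp
    ring
  exact h.exp.congr_deriv (mul_comm _ _)

/-- The second derivative has the sign of `u² - 4`; this is what makes `1 / 8` the largest
admissible learning rate for observations and predictions in `[-1, 1]`. -/
theorem concaveOn_exp_neg_sq : ConcaveOn ℝ (Set.Icc (-2 : ℝ) 2) fun u => rexp (-u ^ 2 / 8) := by
  have h2 : ∀ u : ℝ, HasDerivAt (fun u : ℝ => -(u / 4) * rexp (-u ^ 2 / 8))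
      ((u ^ 2 / 16 - 1 / 4) * rexp (-u ^ 2 / 8)) u := fun u =>
    ((((hasDerivAt_id' u).div_const 4).fun_neg).fun_mul (hasDerivAt_exp_neg_sq u)).congr_deriv
      (by ring)
  refine concaveOn_of_hasDerivWithinAt2_nonpos (convex_Icc _ _) (by fun_prop)
    (fun u _ => (hasDerivAt_exp_neg_sq u).hasDerivWithinAt) (fun u _ => (h2 u).hasDerivWithinAt)
    fun u hu => ?_
  rw [interior_Icc] at hu
  exact mul_nonpos_of_nonpos_of_nonneg (by nlinarith [hu.1, hu.2]) (exp_pos _).le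

theorem exp_neg_sq_le_tangent {u v : ℝ} (hu : u ∈ Set.Icc (-2 : ℝ) 2)
    (hv : v ∈ Set.Icc (-2 : ℝ) 2) :
    rexp (-v ^ 2 / 8) ≤ rexp (-u ^ 2 / 8) + -(u / 4) * rexp (-u ^ 2 / 8) * (v - u) := by
  have h1 := hasDerivAt_exp_neg_sq u
  rcases lt_trichotomy u v with h | rfl | h
  · have := concaveOn_exp_neg_sq.slope_le_of_hasDerivAt hu hv h h1
    rw [slope_def_field, div_le_iff₀ (by linarith)] at this
    linarith
  · simp
  · have := concaveOn_exp_neg_sq.le_slope_of_hasDerivAt hv hu h h1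
    rw [slope_def_field, le_div_iff₀ (by linarith)] at this
    linarith

theorem Strategy.loss_nonneg {X : Type*} (S : Strategy X) : ∀ t, 0 ≤ Strategy.loss S t
  | [] => le_rfl
  | (x, y) :: t => by
    have := Strategy.loss_nonneg S t
    simp only [Strategy.loss]
    positivity

theorem Strategy.loss_history {X : Type*} (S : Strategy X) (x : ℕ → X) (y : ℕ → ℝ) (N : ℕ) :
    Strategy.loss S (history x y N) = ∑ n ∈ Finset.range N, (y n - S.prediction x y n) ^ 2 := by
  induction N with
  | zero => simp [history, Strategy.loss]
  | succ n ih => simp [history, Strategy.loss, Finset.sum_range_succ, ih, Strategy.prediction]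

/-- The predictions of `S` are in `[-1, 1]`. -/
def Strategy.IsBounded {X : Type*} (S : Strategy X) : Prop :=
  ∀ t x, S t x ∈ Set.Icc (-1 : ℝ) 1

theorem isBounded_clippedRule {X : Type*} (F : X → ℝ) : (clippedRule F).IsBounded :=
  fun _ _ => ⟨le_max_left _ _, max_le (by norm_num) (min_le_left _ _)⟩

section Aggregating

variable {X ι : Type*} {w : ι → ℝ} {S : ι → Strategy X}

theorem summable_weights (hw : ∀ i, 0 < w i) (hs : Summable w) (t : List (X × ℝ)) :
    Summable fun i => w i * rexp (-(Strategy.loss (S i) t) / 8) := by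
  refine Summable.of_nonneg_of_le (fun i => ?_) (fun i => ?_) hs
  · have := hw i
    positivity
  · refine mul_le_of_le_one_right (hw i).le (exp_le_one_iff.2 ?_)
    have := Strategy.loss_nonneg (S i) t
    linarith

theorem summable_mul_of_mem_Icc {a γ : ι → ℝ} (ha : ∀ i, 0 ≤ a i) (hs : Summable a)
    (hγ : ∀ i, γ i ∈ Set.Icc (-1 : ℝ) 1) : Summable fun i => a i * γ i := by
  refine Summable.of_norm_bounded hs fun i => ?_
  rw [norm_mul, Real.norm_of_nonneg (ha i)]
  exact mul_le_of_le_one_right (ha i) (abs_le.2 (hγ i))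

theorem Strategy.IsBounded.aaMixture (hw : ∀ i, 0 < w i) (hs : Summable w)
    (hS : ∀ i, (S i).IsBounded) : (aaMixture w S).IsBounded := by
  intro t x
  have ha := summable_weights (S := S) hw hs t
  have ha0 : ∀ i, 0 ≤ w i * rexp (-(Strategy.loss (S i) t) / 8) := fun i => by
    have := hw i
    positivity
  refine Set.mem_Icc.2 (abs_le.1 ?_)
  simp only [OnlineRegression.aaMixture]
  rw [abs_div, abs_of_nonneg (tsum_nonneg ha0), ← Real.norm_eq_abs]
  refine div_le_one_of_le₀ ?_ (tsum_nonneg ha0)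
  refine tsum_of_norm_bounded ha.hasSum fun i => ?_
  rw [norm_mul, Real.norm_of_nonneg (ha0 i)]
  exact mul_le_of_le_one_right (ha0 i) (abs_le.2 (hS i t x))

/-- Jensen's inequality for countably many weights: in the tangent bound at `y - g`, the linear
terms cancel on summation because `g` is the weighted mean of the `γ i`. -/
theorem tsum_mul_exp_le {a γ : ι → ℝ} (ha : ∀ i, 0 ≤ a i) (hs : Summable a)
    (hγ : ∀ i, γ i ∈ Set.Icc (-1 : ℝ) 1) (hpos : 0 < ∑' i, a i) {y g : ℝ}
    (hy : y ∈ Set.Icc (-1 : ℝ) 1) (hg : g ∈ Set.Icc (-1 : ℝ) 1)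
    (hgeq : g = (∑' i, a i * γ i) / ∑' i, a i) :
    ∑' i, a i * rexp (-(y - γ i) ^ 2 / 8) ≤ (∑' i, a i) * rexp (-(y - g) ^ 2 / 8) := by
  have hsγ := summable_mul_of_mem_Icc ha hs hγ
  set φ := rexp (-(y - g) ^ 2 / 8)
  set ψ := (y - g) / 4 * φ
  have hsum : HasSum (fun i => a i * (φ - ψ * g) + ψ * (a i * γ i))
      ((∑' i, a i) * (φ - ψ * g) + ψ * ∑' i, a i * γ i) :=
    (hs.hasSum.mul_right _).add (hsγ.hasSum.mul_left _)
  have hle : ∀ i, a i * rexp (-(y - γ i) ^ 2 / 8) ≤ a i * (φ - ψ * g) + ψ * (a i * γ i) := by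
    intro i
    have h := exp_neg_sq_le_tangent (u := y - g) (v := y - γ i)
      ⟨by linarith [hy.1, hg.2], by linarith [hy.2, hg.1]⟩
      ⟨by linarith [hy.1, (hγ i).2], by linarith [hy.2, (hγ i).1]⟩
    calc _ ≤ a i * (φ + -((y - g) / 4) * φ * (y - γ i - (y - g))) :=
          mul_le_mul_of_nonneg_left h (ha i)
      _ = _ := by simp only [ψ]; ring
  have hval : (∑' i, a i) * (φ - ψ * g) + ψ * ∑' i, a i * γ i = (∑' i, a i) * φ := by
    rw [hgeq]
    field_simp
    ring
  rw [← hval, ← hsum.tsum_eq]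
  refine Summable.tsum_le_tsum hle (Summable.of_nonneg_of_le (fun i => ?_) hle hsum.summable)
    hsum.summable
  exact mul_nonneg (ha i) (exp_pos _).le

/-- Rounds with observations in `[-1, 1]`. -/
def AdmissibleHistory (t : List (X × ℝ)) : Prop := ∀ p ∈ t, p.2 ∈ Set.Icc (-1 : ℝ) 1

theorem admissibleHistory_history {x : ℕ → X} {y : ℕ → ℝ} (hy : ∀ n, y n ∈ Set.Icc (-1 : ℝ) 1)
    (N : ℕ) : AdmissibleHistory (history x y N) := by
  induction N with
  | zero => simp [history, AdmissibleHistory]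
  | succ n ih =>
    intro p hp
    rcases List.mem_cons.1 hp with rfl | hp
    · exact hy n
    · exact ih p hp

/-- The total current weight is a potential: by the Jensen step, each round shrinks it by at least
the factor `exp (-loss / 8)` of the mixture. -/
theorem tsum_weights_le [Nonempty ι] (hw : ∀ i, 0 < w i) (hs : Summable w)
    (hS : ∀ i, (S i).IsBounded) {t : List (X × ℝ)} (ht : AdmissibleHistory t) :
    ∑' i, w i * rexp (-(Strategy.loss (S i) t) / 8) ≤
      (∑' i, w i) * rexp (-(Strategy.loss (aaMixture w S) t) / 8) := by
  induction t with
  | nil => simp [Strategy.loss]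
  | cons p t ih =>
    obtain ⟨x, y⟩ := p
    have ih := ih fun q hq => ht q (List.mem_cons_of_mem _ hq)
    have hy : y ∈ Set.Icc (-1 : ℝ) 1 := ht (x, y) List.mem_cons_self
    have ha := summable_weights (S := S) hw hs t
    have ha0 : ∀ i, 0 < w i * rexp (-(Strategy.loss (S i) t) / 8) := fun i =>
      mul_pos (hw i) (exp_pos _)
    have hpos := ha.tsum_pos (fun i => (ha0 i).le) (Classical.arbitrary ι) (ha0 _)
    have key := tsum_mul_exp_le (fun i => (ha0 i).le) ha (fun i => hS i t x) hpos hy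
      (Strategy.IsBounded.aaMixture hw hs hS t x) rfl
    have hsplit : ∀ T : Strategy X, rexp (-(Strategy.loss T ((x, y) :: t)) / 8) =
        rexp (-(Strategy.loss T t) / 8) * rexp (-(y - T t x) ^ 2 / 8) := fun T => by
      rw [← exp_add]
      simp only [Strategy.loss]
      ring_nf
    simp only [hsplit, ← mul_assoc]
    exact key.trans (mul_le_mul_of_nonneg_right ih (exp_pos _).le)

theorem loss_aaMixture_le (hw : ∀ i, 0 < w i) (hs : Summable w) (hs1 : ∑' i, w i ≤ 1)
    (hS : ∀ i, (S i).IsBounded) {t : List (X × ℝ)} (ht : AdmissibleHistory t) (i : ι) :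
    Strategy.loss (aaMixture w S) t ≤ Strategy.loss (S i) t + 8 * log (w i)⁻¹ := by
  have : Nonempty ι := ⟨i⟩
  have h1 : w i * rexp (-(Strategy.loss (S i) t) / 8) ≤
      rexp (-(Strategy.loss (aaMixture w S) t) / 8) :=
    ((summable_weights hw hs t).le_tsum i
      fun j _ => (mul_pos (hw j) (exp_pos _)).le).trans
      ((tsum_weights_le hw hs hS ht).trans (mul_le_of_le_one_left (exp_pos _).le hs1))
  have h2 := log_le_log (mul_pos (hw i) (exp_pos _)) h1
  rw [log_mul (hw i).ne' (exp_pos _).ne', log_exp, log_exp] at h2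
  rw [log_inv]
  linarith

end Aggregating

/-! ### The weights -/

theorem hasSum_inv_sq_weights : HasSum (fun i : ℕ => 6 / π ^ 2 * (((i : ℝ) + 1) ^ 2)⁻¹) 1 := by
  have h := (hasSum_nat_add_iff' 1).2 hasSum_zeta_two
  have h1 : 6 / π ^ 2 * (π ^ 2 / 6 - ∑ i ∈ Finset.range 1, 1 / (i : ℝ) ^ 2) = 1 := by
    norm_num
  have := h.mul_left (6 / π ^ 2)
  rw [h1] at this
  simpa using this

section

variable {X : Type*} [TopologicalSpace X]

theorem compactWeights_pos {net : ℕ → Finset C(X, ℝ)} (hne : ∀ j, (net j).Nonempty)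
    (p : Σ j : ℕ, {g : C(X, ℝ) // g ∈ net j}) :
    0 < 6 / π ^ 2 * (((p.1 : ℝ) + 1) ^ 2)⁻¹ * ((net p.1).card : ℝ)⁻¹ := by
  have := (hne p.1).card_pos
  positivity

theorem hasSum_compactWeights {net : ℕ → Finset C(X, ℝ)} (hne : ∀ j, (net j).Nonempty) :
    HasSum (fun p : Σ j : ℕ, {g : C(X, ℝ) // g ∈ net j} =>
      6 / π ^ 2 * (((p.1 : ℝ) + 1) ^ 2)⁻¹ * ((net p.1).card : ℝ)⁻¹) 1 := by
  have h : ∀ j, HasSum (fun _ : {g : C(X, ℝ) // g ∈ net j} =>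
      6 / π ^ 2 * (((j : ℝ) + 1) ^ 2)⁻¹ * ((net j).card : ℝ)⁻¹)
      (6 / π ^ 2 * (((j : ℝ) + 1) ^ 2)⁻¹) := fun j => by
    have hc : ((net j).card : ℝ) ≠ 0 := by exact_mod_cast (hne j).card_pos.ne'
    have := hasSum_fintype fun _ : {g : C(X, ℝ) // g ∈ net j} =>
      6 / π ^ 2 * (((j : ℝ) + 1) ^ 2)⁻¹ * ((net j).card : ℝ)⁻¹
    rwa [Finset.sum_const, Finset.card_univ, Fintype.card_coe, nsmul_eq_mul,
      mul_left_comm, mul_inv_cancel₀ hc, mul_one] at this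
  refine HasSum.sigma_of_hasSum hasSum_inv_sq_weights h
    ((summable_sigma_of_nonneg fun p => (compactWeights_pos hne p).le).2
      ⟨fun j => (h j).summable, ?_⟩)
  simpa only [(h _).tsum_eq] using hasSum_inv_sq_weights.summable

theorem isBounded_compactStrategy {net : ℕ → Finset C(X, ℝ)} (hne : ∀ j, (net j).Nonempty) :
    (compactStrategy net).IsBounded :=
  Strategy.IsBounded.aaMixture (compactWeights_pos hne) (hasSum_compactWeights hne).summable
    fun _ => isBounded_clippedRule _

theorem loss_banachStrategy_le {net : ℕ → ℕ → Finset C(X, ℝ)}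
    (hne : ∀ i j, (net i j).Nonempty) {t : List (X × ℝ)} (ht : AdmissibleHistory t)
    (i j : ℕ) {g : C(X, ℝ)} (hg : g ∈ net i j) :
    Strategy.loss (banachStrategy net) t ≤ Strategy.loss (clippedRule g) t +
      8 * (log (net i j).card + 2 * log (i + 1) + 2 * log (j + 1) + 2 * log (π ^ 2 / 6)) := by
  have h1 := loss_aaMixture_le (S := fun i => compactStrategy (net i)) (fun i => by positivity)
    hasSum_inv_sq_weights.summable hasSum_inv_sq_weights.tsum_eq.le
    (fun i => isBounded_compactStrategy (hne i)) ht i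
  have h2 := loss_aaMixture_le (S := fun p : Σ j : ℕ, {g : C(X, ℝ) // g ∈ net i j} =>
      clippedRule (p.2 : C(X, ℝ))) (compactWeights_pos (hne i))
    (hasSum_compactWeights (hne i)).summable (hasSum_compactWeights (hne i)).tsum_eq.le
    (fun _ => isBounded_clippedRule _) ht ⟨j, g, hg⟩
  have hc : ((net i j).card : ℝ) ≠ 0 := by exact_mod_cast (hne i j).card_pos.ne'
  have hi : ((i : ℝ) + 1) ≠ 0 := by positivity
  have hj : ((j : ℝ) + 1) ≠ 0 := by positivity
  have hπ : π ^ 2 / 6 ≠ 0 := by positivity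
  have e1 : log (6 / π ^ 2 * (((i : ℝ) + 1) ^ 2)⁻¹)⁻¹ = log (π ^ 2 / 6) + 2 * log (i + 1) := by
    rw [mul_inv, inv_inv, inv_div, log_mul hπ (pow_ne_zero _ hi), log_pow]
    norm_num
  have e2 : log (6 / π ^ 2 * (((j : ℝ) + 1) ^ 2)⁻¹ * ((net i j).card : ℝ)⁻¹)⁻¹ =
      log (π ^ 2 / 6) + 2 * log (j + 1) + log (net i j).card := by
    rw [mul_inv, mul_inv, inv_inv, inv_inv, inv_div,
      log_mul (mul_ne_zero hπ (pow_ne_zero _ hj)) hc, log_mul hπ (pow_ne_zero _ hj), log_pow]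
    norm_num
  rw [e1] at h1
  simp only [e2] at h2
  have h1' : Strategy.loss (banachStrategy net) t ≤ Strategy.loss (compactStrategy (net i)) t +
      8 * (log (π ^ 2 / 6) + 2 * log (i + 1)) := h1
  have h2' : Strategy.loss (compactStrategy (net i)) t ≤ Strategy.loss (clippedRule g) t +
      8 * (log (π ^ 2 / 6) + 2 * log (j + 1) + log (net i j).card) := h2
  linarith

end

theorem loss_clippedRule_le {X : Type*} {F g : X → ℝ} {δ : ℝ} (hFg : ∀ x, |F x - g x| ≤ δ)
    {x : ℕ → X} {y : ℕ → ℝ} (hy : ∀ n, y n ∈ Set.Icc (-1 : ℝ) 1) (N : ℕ) :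
    Strategy.loss (clippedRule g) (history x y N) ≤
      ∑ n ∈ Finset.range N, (y n - F (x n)) ^ 2 + N * (4 * δ) := by
  -- With `b` the truncated prediction, `(y - b)² - (y - a)² = 2 (y - b)(a - b) - (a - b)²` and `|y
  -- - b| ≤ 2`. When truncation is active and `a` lies outside `[-1, 1]` on the same side, the
  -- truncated prediction is no worse than `a`, so `F` itself need not be bounded by 1.
  have hstep : ∀ n, (y n - (clippedRule g).prediction x y n) ^ 2 ≤
      (y n - F (x n)) ^ 2 + 4 * δ := by
    intro n
    obtain ⟨hy1, hy2⟩ := hy n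
    have h := hFg (x n)
    simp only [Strategy.prediction, clippedRule]
    generalize F (x n) = a at *
    generalize g (x n) = b at *
    generalize y n = z at *
    obtain ⟨h1, h2⟩ := abs_le.1 h
    rcases le_total 1 b with hb | hb
    · rw [min_eq_left hb, max_eq_right (by norm_num)]
      rcases le_total 1 a with ha | ha
      · nlinarith
      · nlinarith [sq_nonneg (1 - a)]
    · rw [min_eq_right hb]
      rcases le_total (-1) b with hb' | hb'
      · rw [max_eq_right hb']
        nlinarith [sq_nonneg (a - b)]
      · rw [max_eq_left hb']
        rcases le_total (-1) a with ha | ha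
        · nlinarith [sq_nonneg (1 + a)]
        · nlinarith
  rw [Strategy.loss_history]
  refine (Finset.sum_le_sum fun n _ => hstep n).trans ?_
  rw [Finset.sum_add_distrib, Finset.sum_const, Finset.card_range, nsmul_eq_mul]

/-! ### Fourier coefficients of functions analytic in a strip -/

theorem IsContinuation.mono {D D' : Set ℂ} {F : C(Signal, ℝ)} {f : ℂ → ℂ}
    (hf : IsContinuation D F f) (h : D' ⊆ D) : IsContinuation D' F f :=
  ⟨hf.1.mono h, hf.2⟩

theorem isPreconnected_openStrip (a : ℝ) : IsPreconnected (openStrip a) := by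
  have : openStrip a = Complex.imLm ⁻¹' Set.Ioo (-a) a := by
    ext z
    simp [openStrip, abs_lt]
  rw [this]
  exact ((convex_Ioo (-a) a).linear_preimage Complex.imLm).isPreconnected

/-- Identity theorem: both sides are analytic in the strip and agree on the real line, which
accumulates at `0`. -/
theorem IsContinuation.periodic {a : ℝ} (ha : 0 < a) {F : C(Signal, ℝ)} {f : ℂ → ℂ}
    (hf : IsContinuation (openStrip a) F f) {z : ℂ} (hz : z ∈ openStrip a) :
    f (z + 2 * π) = f z := by
  have him : ∀ w : ℂ, (w + 2 * π).im = w.im := fun w => by simp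
  have hg : AnalyticOnNhd ℂ (fun z => f (z + 2 * π)) (openStrip a) := by
    refine hf.1.comp (analyticOnNhd_id.add analyticOnNhd_const) fun w hw => ?_
    simpa [openStrip, him] using hw
  refine hg.eqOn_of_preconnected_of_frequently_eq hf.1 (isPreconnected_openStrip a) (z₀ := 0)
    (by simpa [openStrip] using ha) ?_ hz
  have ht : Filter.Tendsto ((↑) : ℝ → ℂ) (nhdsWithin 0 {0}ᶜ) (nhdsWithin 0 {0}ᶜ) := by
    refine tendsto_nhdsWithin_iff.2 ⟨?_, ?_⟩
    · exact (Complex.continuous_ofReal.tendsto' 0 0 (by simp)).mono_left nhdsWithin_le_nhds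
    · filter_upwards [self_mem_nhdsWithin] with x hx
      simpa using hx
  refine ht.frequently (Filter.Eventually.frequently (Filter.Eventually.of_forall fun x => ?_))
  have h1 := hf.2 (x + 2 * π)
  have h2 : ((x + 2 * π : ℝ) : Signal) = (x : Signal) := AddCircle.coe_add_period (2 * π) x
  rw [h2, ← hf.2 x] at h1
  push_cast at h1
  exact h1

/-- The function `F` as a complex-valued function. -/
noncomputable def complexify (F : C(Signal, ℝ)) : C(Signal, ℂ) :=
  ⟨fun t => (F t : ℂ), Complex.continuous_ofReal.comp F.continuous⟩

theorem fourier_signal (n : ℤ) (x : ℝ) :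
    fourier n (x : Signal) = Complex.exp (Complex.I * n * x) := by
  rw [fourier_coe_apply]
  congr 1
  have : (π : ℂ) ≠ 0 := by exact_mod_cast pi_ne_zero
  push_cast
  field_simp

theorem norm_exp_I_mul (n : ℤ) (z : ℂ) :
    ‖Complex.exp (Complex.I * n * z)‖ = rexp (-(n * z.im)) := by
  rw [Complex.norm_exp]
  simp [Complex.mul_re]

/-- Cauchy's theorem on the rectangle over a full period; the vertical sides cancel by periodicity.
-/
theorem IsContinuation.integral_shift {a : ℝ} (ha : 0 < a) {F : C(Signal, ℝ)} {f : ℂ → ℂ}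
    (hf : IsContinuation (openStrip a) F f) (n : ℤ) {η : ℝ} (hη : |η| < a) :
    ∫ x in (0 : ℝ)..2 * π, Complex.exp (Complex.I * n * x) * f x =
      ∫ x in (0 : ℝ)..2 * π, Complex.exp (Complex.I * n * (x + η * Complex.I)) *
        f (x + η * Complex.I) := by
  set g : ℂ → ℂ := fun z => Complex.exp (Complex.I * n * z) * f z with hg
  have hrect : Set.uIcc (0 : ℂ).re (2 * π + η * Complex.I : ℂ).re ×ℂ
      Set.uIcc (0 : ℂ).im (2 * π + η * Complex.I : ℂ).im ⊆ openStrip a := by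
    intro z hz
    have hz2 : z.im ∈ Set.uIcc (0 : ℝ) η := by simpa using hz.2
    have := Set.abs_sub_left_of_mem_uIcc hz2
    simp only [sub_zero] at this
    exact this.trans_lt hη
  have hd : DifferentiableOn ℂ g (openStrip a) :=
    DifferentiableOn.mul (by fun_prop) hf.1.differentiableOn
  have key := Complex.integral_boundary_rect_eq_zero_of_differentiableOn g 0
    (2 * π + η * Complex.I) (hd.mono hrect)
  have hper : ∀ y ∈ Set.uIcc (0 : ℝ) η, g (2 * π + y * Complex.I) = g (0 + y * Complex.I) := by
    intro y hy
    have hy' : ((y : ℂ) * Complex.I) ∈ openStrip a := by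
      have := Set.abs_sub_left_of_mem_uIcc hy
      simp only [sub_zero] at this
      simpa [openStrip] using this.trans_lt hη
    have h1 := hf.periodic ha hy'
    simp only [hg, zero_add]
    rw [add_comm, h1]
    congr 1
    rw [mul_add, Complex.exp_add]
    have : Complex.I * n * (2 * π) = n * (2 * π * Complex.I) := by ring
    rw [this, Complex.exp_int_mul_two_pi_mul_I, mul_one]
  have hvert : ∫ y in (0 : ℝ)..η, g (2 * π + y * Complex.I) =
      ∫ y in (0 : ℝ)..η, g (0 + y * Complex.I) := intervalIntegral.integral_congr hper
  simp only [Complex.zero_re, Complex.zero_im, Complex.ofReal_zero, zero_mul, add_zero,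
    Complex.add_re, Complex.mul_re, Complex.re_ofNat, Complex.ofReal_re, Complex.im_ofNat,
    Complex.ofReal_im, Complex.I_re, Complex.I_im, mul_zero, mul_one, sub_zero, sub_self,
    Complex.add_im, Complex.mul_im, Complex.ofReal_mul, Complex.ofReal_ofNat] at key
  simp only [zero_add] at key hvert
  rw [hvert] at key
  rw [add_sub_cancel_right] at key
  exact sub_eq_zero.1 key

theorem norm_fourierCoeff_le {a : ℝ} (ha : 0 < a) {F : C(Signal, ℝ)} {f : ℂ → ℂ}
    (hf : IsContinuation (openStrip a) F f) {R : ℝ} (hR : ∀ z ∈ openStrip a, ‖f z‖ ≤ R)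
    {b : ℝ} (hb : 0 ≤ b) (hba : b < a) (n : ℤ) :
    ‖fourierCoeff (complexify F) n‖ ≤ R * rexp (-(|(n : ℝ)| * b)) := by
  -- The contour is moved away from the real axis in the direction in which `exp (-i n z)` decays.
  obtain ⟨η, hη, hηn⟩ : ∃ η : ℝ, |η| = b ∧ (n : ℝ) * η = -(|(n : ℝ)| * b) := by
    rcases le_total (0 : ℝ) n with h | h
    · exact ⟨-b, by rw [abs_neg, abs_of_nonneg hb], by rw [abs_of_nonneg h]; ring⟩
    · exact ⟨b, abs_of_nonneg hb, by rw [abs_of_nonpos h]; ring⟩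
  rw [fourierCoeff_eq_intervalIntegral _ n 0, zero_add]
  have h1 : ∀ x : ℝ, (fourier (-n) (x : Signal)) • complexify F (x : Signal) =
      Complex.exp (Complex.I * (-n : ℤ) * x) * f x := fun x => by
    rw [fourier_signal, hf.2 x]
    rfl
  simp only [h1]
  rw [hf.integral_shift ha (-n) (hη.trans_lt hba), norm_smul, Real.norm_of_nonneg (by positivity),
    ← hηn]
  have h2 : ∀ x : ℝ, ‖Complex.exp (Complex.I * (-n : ℤ) * (x + η * Complex.I)) *
      f (x + η * Complex.I)‖ ≤ R * rexp (n * η) := fun x => by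
    rw [norm_mul, norm_exp_I_mul, mul_comm]
    refine mul_le_mul (hR _ ?_) (le_of_eq ?_) (exp_pos _).le
      ((norm_nonneg _).trans (hR 0 (by simpa [openStrip] using ha)))
    · simpa [openStrip, hη] using hba
    · simp
  have h3 := intervalIntegral.norm_integral_le_of_norm_le_const (a := 0) (b := 2 * π)
    fun x _ => h2 x
  rw [sub_zero, abs_of_pos Real.two_pi_pos] at h3
  calc _ ≤ 1 / (2 * π) * (R * rexp (n * η) * (2 * π)) := by gcongr
    _ = _ := by field_simp

theorem summable_exp_neg_abs {a : ℝ} (ha : 0 < a) :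
    Summable fun n : ℤ => rexp (-(|(n : ℝ)| * a)) := by
  have h : Summable fun n : ℕ => rexp (-(n * a)) := by
    have := summable_geometric_of_lt_one (exp_pos (-a)).le (exp_lt_one_iff.2 (by linarith))
    refine this.congr fun n => ?_
    rw [← exp_nat_mul]
    ring_nf
  exact Summable.of_nat_of_neg (by simpa using h) (by simpa using h)

/-- The factor in the bound for the tails of a Fourier series. -/
noncomputable def tailConst (a : ℝ) : ℝ := ∑' n : ℤ, rexp (-(|(n : ℝ)| * (a / 2)))

theorem tailConst_nonneg (a : ℝ) : 0 ≤ tailConst a := tsum_nonneg fun _ => (exp_pos _).le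

theorem norm_le_of_hasSum {u : ℤ → ℂ} {s : ℂ} (hu : HasSum u s) {K : ℕ} {δ R a : ℝ}
    (ha : 0 < a) (hR : 0 ≤ R) (hδ : ∀ n ∈ Finset.Icc (-K : ℤ) K, ‖u n‖ ≤ δ)
    (htail : ∀ n ∉ Finset.Icc (-K : ℤ) K, ‖u n‖ ≤ R * rexp (-(|(n : ℝ)| * a))) :
    ‖s‖ ≤ (2 * K + 1) * δ + R * tailConst a * rexp (-(K * (a / 2))) := by
  have h1 : HasSum (fun n : ℤ => if n ∈ Finset.Icc (-K : ℤ) K then δ else 0)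
      ((2 * K + 1) * δ) := by
    have := hasSum_sum_of_ne_finset_zero (L := .unconditional ℤ) (f := fun n : ℤ =>
      if n ∈ Finset.Icc (-K : ℤ) K then δ else 0) (s := Finset.Icc (-K : ℤ) K)
      fun n hn => if_neg hn
    rw [Finset.sum_congr rfl fun n hn => if_pos hn, Finset.sum_const, Int.card_Icc,
      nsmul_eq_mul] at this
    convert this using 2
    rw [show (K + 1 - -K : ℤ) = ((2 * K + 1 : ℕ) : ℤ) by push_cast; ring, Int.toNat_natCast]
    push_cast
    ring
  have h2 := ((summable_exp_neg_abs (half_pos ha)).hasSum.mul_left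
    (R * rexp (-(K * (a / 2)))))
  have h3 := hu.norm_le_of_bounded (h1.add h2) fun n => ?_
  · refine h3.trans (le_of_eq ?_)
    simp only [tailConst]
    ring
  · by_cases hn : n ∈ Finset.Icc (-K : ℤ) K
    · rw [if_pos hn]
      exact (hδ n hn).trans (le_add_of_nonneg_right (by positivity))
    · rw [if_neg hn, zero_add]
      refine (htail n hn).trans ?_
      -- Half of the decay rate supplies the small factor `exp (-K a / 2)`; the other half keeps the
      -- series summable.
      rw [mul_assoc, ← exp_add]
      gcongr
      have : (K : ℝ) ≤ |(n : ℝ)| := by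
        have : (K : ℤ) ≤ |n| := by
          by_contra! hlt
          exact hn (Finset.mem_Icc.2 (abs_le.1 hlt.le))
        exact_mod_cast this
      nlinarith

theorem hasSum_fourierCoeff {F : C(Signal, ℝ)} {R a : ℝ} (ha : 0 < a)
    (hF : ∀ n, ‖fourierCoeff (complexify F) n‖ ≤ R * rexp (-(|(n : ℝ)| * a))) (t : Signal) :
    HasSum (fun n => fourierCoeff (complexify F) n * fourier n t) (F t : ℂ) :=
  has_pointwise_sum_fourier_series_of_summable (f := complexify F)
    (Summable.of_norm_bounded ((summable_exp_neg_abs ha).mul_left R) hF) t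

theorem norm_fourier_apply (n : ℤ) (t : Signal) : ‖fourier n t‖ = 1 := by
  rw [fourier_apply]
  exact Circle.norm_coe _

theorem nonneg_of_forall_fourierCoeff_le {F : C(Signal, ℝ)} {R a : ℝ}
    (hF : ∀ n, ‖fourierCoeff (complexify F) n‖ ≤ R * rexp (-(|(n : ℝ)| * a))) : 0 ≤ R := by
  simpa using (norm_nonneg _).trans (hF 0)

theorem dist_le_of_fourierCoeff {F G : C(Signal, ℝ)} {R a δ : ℝ} (ha : 0 < a) {K : ℕ}
    (hF : ∀ n, ‖fourierCoeff (complexify F) n‖ ≤ R * rexp (-(|(n : ℝ)| * a)))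
    (hG : ∀ n, ‖fourierCoeff (complexify G) n‖ ≤ R * rexp (-(|(n : ℝ)| * a)))
    (hFG : ∀ n ∈ Finset.Icc (-K : ℤ) K,
      ‖fourierCoeff (complexify F) n - fourierCoeff (complexify G) n‖ ≤ δ) :
    dist F G ≤ (2 * K + 1) * δ + 2 * R * tailConst a * rexp (-(K * (a / 2))) := by
  have hR := nonneg_of_forall_fourierCoeff_le hF
  have hpt : ∀ t, dist (F t) (G t) ≤
      (2 * K + 1) * δ + 2 * R * tailConst a * rexp (-(K * (a / 2))) := by
    intro t
    have h := norm_le_of_hasSum ((hasSum_fourierCoeff ha hF t).sub (hasSum_fourierCoeff ha hG t))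
      (K := K) (δ := δ) (R := 2 * R) ha (by positivity) (fun n hn => ?_) fun n _ => ?_
    · rwa [← Complex.ofReal_sub, Complex.norm_real] at h
    · rw [← sub_mul, norm_mul, norm_fourier_apply, mul_one]
      exact hFG n hn
    · rw [← sub_mul, norm_mul, norm_fourier_apply, mul_one]
      refine (norm_sub_le _ _).trans ?_
      linarith [hF n, hG n]
  exact (ContinuousMap.dist_le (dist_nonneg.trans (hpt 0))).2 hpt

/-! ### Trigonometric polynomials -/

/-- The real part of a trigonometric polynomial. -/
noncomputable def trigPoly (m : ℕ) (c : ℤ → ℂ) : C(Signal, ℝ) :=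
  ⟨fun t => (∑ n ∈ Finset.Icc (-m : ℤ) m, c n * fourier n t).re,
    Complex.continuous_re.comp (by fun_prop)⟩

theorem trigPoly_mem_analyticBall {D : Set ℂ} {H : ℝ} (hD : D ⊆ closedStrip H) (m : ℕ)
    {c : ℤ → ℂ} {R : ℝ} (hc : ∀ n, ‖c n‖ ≤ R) :
    trigPoly m c ∈ analyticBall D ((2 * m + 1) * (R * rexp (m * H))) := by
  -- The real part is not analytic off the real line; there it is replaced by the half-sum with the
  -- conjugate coefficients and opposite frequencies.
  refine ⟨fun z => ∑ n ∈ Finset.Icc (-m : ℤ) m, (c n * Complex.exp (Complex.I * n * z) +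
    (starRingEnd ℂ) (c n) * Complex.exp (Complex.I * (-n : ℤ) * z)) / 2, ⟨?_, fun t => ?_⟩,
    fun z hz => ?_⟩
  · have : Differentiable ℂ fun z => ∑ n ∈ Finset.Icc (-m : ℤ) m,
        (c n * Complex.exp (Complex.I * n * z) +
          (starRingEnd ℂ) (c n) * Complex.exp (Complex.I * (-n : ℤ) * z)) / 2 := by
      fun_prop
    exact fun z _ => this.analyticAt z
  · simp only [trigPoly, ContinuousMap.coe_mk]
    rw [Complex.re_eq_add_conj, map_sum, ← Finset.sum_add_distrib, Finset.sum_div]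
    refine Finset.sum_congr rfl fun n _ => ?_
    rw [map_mul, ← fourier_neg, fourier_signal, fourier_signal]
  · have hz' : |z.im| ≤ H := hD hz
    have hR : 0 ≤ R := (norm_nonneg _).trans (hc 0)
    have hexp : ∀ n ∈ Finset.Icc (-m : ℤ) m,
        ‖Complex.exp (Complex.I * n * z)‖ ≤ rexp (m * H) := by
      intro n hn
      rw [norm_exp_I_mul]
      have hn' : |(n : ℝ)| ≤ m := by
        have := abs_le.2 (Finset.mem_Icc.1 hn)
        exact_mod_cast this
      refine exp_le_exp.2 ((neg_le_abs _).trans ?_)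
      rw [abs_mul]
      exact mul_le_mul hn' hz' (abs_nonneg _) (Nat.cast_nonneg _)
    have hterm : ∀ n ∈ Finset.Icc (-m : ℤ) m,
        ‖(c n * Complex.exp (Complex.I * n * z) +
          (starRingEnd ℂ) (c n) * Complex.exp (Complex.I * (-n : ℤ) * z)) / 2‖ ≤
          R * rexp (m * H) := by
      intro n hn
      have hn' : -n ∈ Finset.Icc (-m : ℤ) m := by
        rw [Finset.mem_Icc] at hn ⊢
        omega
      have h1 := mul_le_mul (hc n) (hexp n hn) (norm_nonneg _) hR
      have h2 := mul_le_mul (hc n) (hexp _ hn') (norm_nonneg _) hR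
      rw [norm_div, Complex.norm_ofNat, div_le_iff₀ two_pos]
      refine (norm_add_le _ _).trans ?_
      rw [norm_mul, norm_mul, Complex.norm_conj]
      linarith
    refine (norm_sum_le_of_le _ hterm).trans (le_of_eq ?_)
    rw [Finset.sum_const, Int.card_Icc, nsmul_eq_mul,
      show (m + 1 - -m : ℤ) = ((2 * m + 1 : ℕ) : ℤ) by push_cast; ring, Int.toNat_natCast]
    push_cast
    ring

theorem dist_trigPoly_le {F : C(Signal, ℝ)} {R a : ℝ} (ha : 0 < a)
    (hF : ∀ n, ‖fourierCoeff (complexify F) n‖ ≤ R * rexp (-(|(n : ℝ)| * a))) (m : ℕ) :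
    dist F (trigPoly m (fourierCoeff (complexify F))) ≤
      R * tailConst a * rexp (-(m * (a / 2))) := by
  have hR := nonneg_of_forall_fourierCoeff_le hF
  have hpt : ∀ t, dist (F t) (trigPoly m (fourierCoeff (complexify F)) t) ≤
      R * tailConst a * rexp (-(m * (a / 2))) := by
    intro t
    have h1 := hasSum_sum_of_ne_finset_zero (L := .unconditional ℤ) (f := fun n : ℤ =>
      if n ∈ Finset.Icc (-m : ℤ) m then fourierCoeff (complexify F) n * fourier n t else 0)
      (s := Finset.Icc (-m : ℤ) m) fun n hn => if_neg hn
    rw [Finset.sum_congr rfl fun n hn => if_pos hn] at h1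
    have h := norm_le_of_hasSum ((hasSum_fourierCoeff ha hF t).sub h1)
      (K := m) (δ := 0) (R := R) ha hR (fun n hn => ?_) fun n hn => ?_
    · rw [mul_zero, zero_add] at h
      refine le_trans ?_ h
      rw [dist_eq]
      refine le_trans (le_of_eq ?_) (Complex.abs_re_le_norm _)
      simp [trigPoly]
    · rw [if_pos hn, sub_self, norm_zero]
    · rw [if_neg hn, sub_zero, norm_mul, norm_fourier_apply, mul_one]
      exact hF n
  refine (ContinuousMap.dist_le ?_).2 hpt
  exact dist_nonneg.trans (hpt 0)

/-! ### Nets for the balls of the analytic classes -/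

section

variable {E : Type*} [PseudoMetricSpace E] {ε : ℝ} {A : Set E}

/-- Choosing one representative in `A` for each code that occurs keeps the net inside `A`. -/
theorem exists_isNet_of_code {T : Type*} [Fintype T] (Φ : E → T)
    (hΦ : ∀ f ∈ A, ∀ g ∈ A, Φ f = Φ g → dist f g ≤ ε) :
    ∃ s : Finset E, IsNet ε A s ∧ s.card ≤ Fintype.card T := by
  classical
  rcases isEmpty_or_nonempty E with hE | hE
  · exact ⟨∅, ⟨by simp, fun f => (hE.false f).elim⟩, by simp⟩
  choose! r hrA hrΦ using fun (τ : T) (h : ∃ f ∈ A, Φ f = τ) => h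
  refine ⟨(Finset.univ.filter fun τ => ∃ f ∈ A, Φ f = τ).image r, ⟨?_, fun f hf => ?_⟩,
    Finset.card_image_le.trans (Finset.card_le_univ _)⟩
  · intro g hg
    obtain ⟨τ, hτ, rfl⟩ := Finset.mem_image.1 hg
    exact hrA τ (Finset.mem_filter.1 hτ).2
  · have h : ∃ g ∈ A, Φ g = Φ f := ⟨f, hf, rfl⟩
    exact ⟨r (Φ f), Finset.mem_image_of_mem r (Finset.mem_filter.2 ⟨Finset.mem_univ _, h⟩),
      hΦ f hf _ (hrA _ h) (hrΦ _ h).symm⟩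

theorem IsNet.exists_isMinimalNet {s : Finset E} (hs : IsNet ε A s) :
    ∃ s' : Finset E, IsMinimalNet ε A s' := by
  classical
  have h : ∃ k, ∃ s : Finset E, IsNet ε A s ∧ s.card = k := ⟨_, s, hs, rfl⟩
  obtain ⟨s', hs', hk⟩ := Nat.find_spec h
  exact ⟨s', hs', fun t ht => hk ▸ Nat.find_min' h ⟨t, ht, rfl⟩⟩

end

/-- The cell containing `x` in the partition of `[-R, R]` into cells of length `2 * R / M`. -/
noncomputable def gridIndex (R : ℝ) (M : ℕ) (x : ℝ) : Fin (M + 1) :=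
  ⟨min M ⌊(x + R) * M / (2 * R)⌋₊, by omega⟩

/-- Equal floors force the rescaled points to be within 1. On `[-R, R]` the floor never exceeds `M`,
so the `min` in `gridIndex` has no effect. -/
theorem abs_sub_le_of_gridIndex_eq {R : ℝ} (hR : 0 < R) {M : ℕ} (hM : 0 < M) {x y : ℝ}
    (hx : |x| ≤ R) (hy : |y| ≤ R) (h : gridIndex R M x = gridIndex R M y) :
    |x - y| ≤ 2 * R / M := by
  have hM' : (0 : ℝ) < M := by exact_mod_cast hM
  have bound : ∀ z : ℝ, |z| ≤ R →
      0 ≤ (z + R) * M / (2 * R) ∧ ⌊(z + R) * M / (2 * R)⌋₊ ≤ M := by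
    intro z hz
    obtain ⟨h1, h2⟩ := abs_le.1 hz
    refine ⟨div_nonneg (mul_nonneg (by linarith) hM'.le) (by linarith), Nat.floor_le_of_le ?_⟩
    rw [div_le_iff₀ (by linarith)]
    nlinarith
  obtain ⟨hx0, hxM⟩ := bound x hx
  obtain ⟨hy0, hyM⟩ := bound y hy
  have hfl : ⌊(x + R) * M / (2 * R)⌋₊ = ⌊(y + R) * M / (2 * R)⌋₊ := by
    have := congrArg Fin.val h
    simpa only [gridIndex, min_eq_right hxM, min_eq_right hyM] using this
  have h1 := Nat.floor_le hx0
  have h2 := Nat.lt_floor_add_one ((x + R) * M / (2 * R))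
  have h3 := Nat.floor_le hy0
  have h4 := Nat.lt_floor_add_one ((y + R) * M / (2 * R))
  rw [hfl] at h1 h2
  have h5 : |(x + R) * M / (2 * R) - (y + R) * M / (2 * R)| ≤ 1 :=
    abs_le.2 ⟨by linarith, by linarith⟩
  have h6 : (x + R) * M / (2 * R) - (y + R) * M / (2 * R) = (x - y) * (M / (2 * R)) := by ring
  rw [h6, abs_mul, abs_of_pos (by positivity : 0 < M / (2 * R)), ← le_div_iff₀ (by positivity),
    one_div_div] at h5
  exact h5

theorem analyticBall_mono {D : Set ℂ} {R R' : ℝ} (h : R ≤ R') :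
    analyticBall D R ⊆ analyticBall D R' :=
  fun _ ⟨f, hf, hb⟩ => ⟨f, hf, fun z hz => (hb z hz).trans h⟩

theorem zero_mem_analyticBall (D : Set ℂ) {R : ℝ} (hR : 0 ≤ R) : 0 ∈ analyticBall D R :=
  ⟨fun _ => 0, ⟨analyticOnNhd_const, fun _ => by simp⟩, fun _ _ => by simpa using hR⟩

/-- Any rate below `H` is available; the choice `H / 2` affects only the constants. -/
theorem norm_fourierCoeff_le_of_mem_analyticBall {D : Set ℂ} {H R : ℝ} (hH : 0 < H)
    (hD : openStrip H ⊆ D) {F : C(Signal, ℝ)} (hF : F ∈ analyticBall D R) (n : ℤ) :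
    ‖fourierCoeff (complexify F) n‖ ≤ R * rexp (-(|(n : ℝ)| * (H / 2))) := by
  obtain ⟨f, hf, hb⟩ := hF
  exact norm_fourierCoeff_le hH (hf.mono hD) (fun z hz => hb z (hD hz)) (by linarith)
    (by linarith) n

theorem exists_isNet_analyticBall_card_le {D : Set ℂ} {H R ε : ℝ} {K M : ℕ} (hH : 0 < H)
    (hD : openStrip H ⊆ D) (hR : 0 < R) (hM : 0 < M)
    (hε : (2 * K + 1) * (4 * R / M) + 2 * R * tailConst (H / 2) * rexp (-(K * (H / 2 / 2))) ≤ ε) :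
    ∃ s : Finset C(Signal, ℝ), IsNet ε (analyticBall D R) s ∧
      s.card ≤ (M + 1) ^ (2 * (2 * K + 1)) := by
  -- The code rounds the real and imaginary parts of the coefficients with `|n| ≤ K`; each costs `2R
  -- / M`, hence `4R / M` per coefficient.
  let Φ : C(Signal, ℝ) → (Finset.Icc (-K : ℤ) K → Fin (M + 1) × Fin (M + 1)) := fun F n =>
    (gridIndex R M (fourierCoeff (complexify F) n).re,
      gridIndex R M (fourierCoeff (complexify F) n).im)
  have hΦ : ∀ F ∈ analyticBall D R, ∀ G ∈ analyticBall D R, Φ F = Φ G → dist F G ≤ ε := by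
    intro F hF G hG hFG
    have hF' := norm_fourierCoeff_le_of_mem_analyticBall hH hD hF
    have hG' := norm_fourierCoeff_le_of_mem_analyticBall hH hD hG
    have hle : ∀ n : ℤ, R * rexp (-(|(n : ℝ)| * (H / 2))) ≤ R := fun n =>
      mul_le_of_le_one_right hR.le (exp_le_one_iff.2 (neg_nonpos.2 (by positivity)))
    refine (dist_le_of_fourierCoeff (by linarith) hF' hG' (K := K) (δ := 4 * R / M)
      fun n hn => ?_).trans hε
    have h := congrFun hFG ⟨n, hn⟩
    have h1 := abs_sub_le_of_gridIndex_eq hR hM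
      ((Complex.abs_re_le_norm _).trans ((hF' n).trans (hle n)))
      ((Complex.abs_re_le_norm _).trans ((hG' n).trans (hle n))) (congrArg Prod.fst h)
    have h2 := abs_sub_le_of_gridIndex_eq hR hM
      ((Complex.abs_im_le_norm _).trans ((hF' n).trans (hle n)))
      ((Complex.abs_im_le_norm _).trans ((hG' n).trans (hle n))) (congrArg Prod.snd h)
    refine (Complex.norm_le_abs_re_add_abs_im _).trans ?_
    rw [Complex.sub_re, Complex.sub_im]
    calc _ ≤ 2 * R / M + 2 * R / M := add_le_add h1 h2
      _ = _ := by ring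
  obtain ⟨s, hs, hcard⟩ := exists_isNet_of_code Φ hΦ
  refine ⟨s, hs, hcard.trans (le_of_eq ?_)⟩
  rw [Fintype.card_fun, Fintype.card_prod, Fintype.card_fin, Fintype.card_coe, Int.card_Icc,
    show (K + 1 - -K : ℤ) = ((2 * K + 1 : ℕ) : ℤ) by push_cast; ring, Int.toNat_natCast,
    pow_mul, sq]

theorem exists_isNet_analyticBall {D : Set ℂ} {H R ε : ℝ} (hH : 0 < H) (hD : openStrip H ⊆ D)
    (hR : 0 < R) (hε : 0 < ε) : ∃ s : Finset C(Signal, ℝ), IsNet ε (analyticBall D R) s := by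
  have ht : Filter.Tendsto (fun K : ℕ => 2 * R * tailConst (H / 2) * rexp (-(K * (H / 2 / 2))))
      Filter.atTop (nhds (2 * R * tailConst (H / 2) * 0)) := by
    refine Filter.Tendsto.const_mul _ (tendsto_exp_neg_atTop_nhds_zero.comp ?_)
    exact tendsto_natCast_atTop_atTop.atTop_mul_const (by linarith)
  rw [mul_zero] at ht
  obtain ⟨K, hK⟩ := (ht.eventually_le_const (half_pos hε)).exists
  obtain ⟨M, hM⟩ := exists_nat_gt ((2 * K + 1) * (4 * R) / (ε / 2))
  have hM0 : (0 : ℝ) < M := lt_of_le_of_lt (by positivity) hM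
  have hle : (2 * K + 1) * (4 * R / M) ≤ ε / 2 := by
    rw [← mul_div_assoc, div_le_iff₀ hM0]
    rw [div_lt_iff₀ (half_pos hε)] at hM
    linarith
  obtain ⟨s, hs, -⟩ := exists_isNet_analyticBall_card_le (ε := ε) (K := K) (M := M) hH hD hR
    (by exact_mod_cast hM0) (by linarith)
  exact ⟨s, hs⟩

theorem exists_isNetSystem {D : Set ℂ} {H : ℝ} (hH : 0 < H) (hD : openStrip H ⊆ D) :
    ∃ net, IsNetSystem D net := by
  have h : ∀ i j : ℕ, ∃ s : Finset C(Signal, ℝ),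
      IsMinimalNet ((1 / 2 : ℝ) ^ (j + 1)) (analyticBall D (2 ^ (i + 1))) s := fun i j => by
    obtain ⟨s, hs⟩ := exists_isNet_analyticBall (R := 2 ^ (i + 1)) (ε := (1 / 2 : ℝ) ^ (j + 1))
      hH hD (by positivity) (by positivity)
    exact hs.exists_isMinimalNet
  choose net hnet using h
  exact ⟨net, hnet⟩

theorem IsNetSystem.nonempty {D : Set ℂ} {net : ℕ → ℕ → Finset C(Signal, ℝ)}
    (hnet : IsNetSystem D net) (i j : ℕ) : (net i j).Nonempty := by
  obtain ⟨g, hg, -⟩ := (hnet i j).1.2 0 (zero_mem_analyticBall D (by positivity))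
  exact ⟨g, hg⟩

/-! ### Metric entropy of the balls -/

theorem four_pow_add_one_le {n : ℕ} (hn : 1 ≤ n) : (4 : ℝ) ^ n + 1 ≤ rexp (2 * n) := by
  have h5 : (5 : ℝ) ^ n ≤ rexp (2 * n) := by
    rw [mul_comm, exp_nat_mul]
    gcongr
    have := exp_one_gt_d9
    rw [show (2 : ℝ) = 1 + 1 by norm_num, exp_add]
    nlinarith
  refine le_trans ?_ h5
  clear h5
  induction n, hn using Nat.le_induction with
  | base => norm_num
  | succ k hk ih =>
    rw [pow_succ, pow_succ]
    have : (0 : ℝ) < 4 ^ k := by positivity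
    linarith

/-- With `n = p + q`, cutoff `K ≈ 8n / H` and `M = 4 ^ n`, the rounding and tail errors are each at
most half of `2 ^ (-q)`. The threshold involves only `p + q` because the radius will grow with `N`.
-/
theorem eventually_entropy_le {D : Set ℂ} {H : ℝ} (hH : 0 < H) (hD : openStrip H ⊆ D) :
    ∃ n₀ : ℕ, ∀ p q : ℕ, n₀ ≤ p + q → ∀ s : Finset C(Signal, ℝ), s.Nonempty →
      IsMinimalNet ((1 / 2 : ℝ) ^ q) (analyticBall D (2 ^ p)) s →
        log s.card ≤ 68 / H * ((p + q : ℕ) : ℝ) ^ 2 := by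
  have e1 : ∀ᶠ n : ℕ in Filter.atTop, 8 * (16 * n / H + 3) ≤ (2 : ℝ) ^ n := by
    have hc : 0 < (128 / H + 1)⁻¹ := by positivity
    filter_upwards [(isLittleO_coe_const_pow_of_one_lt (R := ℝ) (r := (2 : ℝ)) one_lt_two).bound hc,
      Filter.eventually_ge_atTop 24] with n hn h24
    have h24' : (24 : ℝ) ≤ n := by exact_mod_cast h24
    rw [Real.norm_of_nonneg (by positivity), Real.norm_of_nonneg (by positivity),
      inv_mul_eq_div, le_div_iff₀ (by positivity)] at hn
    have : 8 * (16 * n / H + 3) = n * (128 / H) + 24 := by ring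
    linarith
  have e2 : ∀ᶠ n : ℕ in Filter.atTop, 4 * tailConst (H / 2) ≤ rexp n :=
    (tendsto_exp_atTop.comp tendsto_natCast_atTop_atTop).eventually_ge_atTop _
  have e3 : ∀ᶠ n : ℕ in Filter.atTop, 3 * H ≤ n :=
    tendsto_natCast_atTop_atTop.eventually_ge_atTop _
  obtain ⟨n₀, hn₀⟩ := Filter.eventually_atTop.1
    (e1.and (e2.and (e3.and (Filter.eventually_ge_atTop 1))))
  refine ⟨n₀, fun p q hpq s hne hs => ?_⟩
  obtain ⟨h1, h2, h3, h4⟩ := hn₀ _ hpq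
  obtain ⟨n, hn⟩ : ∃ n, n = p + q := ⟨_, rfl⟩
  rw [← hn] at h1 h2 h3 h4 ⊢
  set K := ⌈8 * n / H⌉₊
  have hK1 : 8 * n / H ≤ K := Nat.le_ceil _
  have hK2 : (K : ℝ) < 8 * n / H + 1 := Nat.ceil_lt_add_one (by positivity)
  have hK3 : (2 * K + 1 : ℝ) ≤ 16 * n / H + 3 := by
    have : 16 * n / H = 2 * (8 * n / H) := by ring
    linarith
  have hpow : (2 : ℝ) ^ p * 2 ^ q = 2 ^ n := by rw [hn, pow_add]
  have hq : (0 : ℝ) < 2 ^ q := by positivity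
  have hp : (0 : ℝ) < 2 ^ p := by positivity
  have hn2 : (0 : ℝ) < 2 ^ n := by positivity
  have hcover : (2 * K + 1) * (4 * 2 ^ p / ((4 ^ n : ℕ) : ℝ)) +
      2 * 2 ^ p * tailConst (H / 2) * rexp (-(K * (H / 2 / 2))) ≤ (1 / 2 : ℝ) ^ q := by
    -- One factor `exp (-n)` beats `2 ^ (p + q)`, the other beats `4 * tailConst (H / 2)`.
    have hexp : rexp (-(K * (H / 2 / 2))) ≤ rexp (-n) * rexp (-n) := by
      rw [← exp_add]
      refine exp_le_exp.2 ?_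
      rw [div_le_iff₀ hH] at hK1
      linarith
    have h2n : (2 : ℝ) ^ n ≤ rexp n := by
      rw [← mul_one (n : ℝ), exp_nat_mul]
      gcongr
      linarith [add_one_le_exp (1 : ℝ)]
    have hen : rexp n * rexp (-n) = 1 := by rw [← exp_add, add_neg_cancel, exp_zero]
    have hhalf : (1 / 2 : ℝ) ^ q * 2 ^ q = 1 := by
      rw [← mul_pow]
      norm_num
    have hB := tailConst_nonneg (H / 2)
    have h4n : ((4 ^ n : ℕ) : ℝ) = 2 ^ n * 2 ^ n := by
      push_cast
      rw [← mul_pow]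
      norm_num
    have t1 : (2 * K + 1) * (4 * 2 ^ p / ((4 ^ n : ℕ) : ℝ)) * 2 ^ q ≤ 1 / 2 := by
      have : (2 * K + 1) * (4 * 2 ^ p / ((4 ^ n : ℕ) : ℝ)) * 2 ^ q = (2 * K + 1) * 4 / 2 ^ n := by
        rw [h4n, ← hpow]
        field_simp
      rw [this, div_le_iff₀ hn2]
      linarith
    have t2 : 2 * 2 ^ p * tailConst (H / 2) * rexp (-(K * (H / 2 / 2))) * 2 ^ q ≤ 1 / 2 := by
      calc _ = 2 * tailConst (H / 2) * 2 ^ n * rexp (-(K * (H / 2 / 2))) := by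
            rw [← hpow]
            ring
        _ ≤ 2 * tailConst (H / 2) * rexp n * (rexp (-n) * rexp (-n)) := by gcongr
        _ = 4 * tailConst (H / 2) / 2 * (rexp n * rexp (-n)) * rexp (-n) := by ring
        _ ≤ rexp n / 2 * (rexp n * rexp (-n)) * rexp (-n) := by gcongr
        _ = 1 / 2 * (rexp n * rexp (-n)) * (rexp n * rexp (-n)) := by ring
        _ = 1 / 2 := by rw [hen]; ring
    refine le_of_mul_le_mul_right ?_ hq
    rw [hhalf, add_mul]
    linarith
  obtain ⟨s', hs', hcard⟩ := exists_isNet_analyticBall_card_le hH hD hp (by positivity) hcover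
  have hsc : (s.card : ℝ) ≤ ((4 : ℝ) ^ n + 1) ^ (2 * (2 * K + 1)) := by
    exact_mod_cast (hs.2 s' hs').trans hcard
  have hs0 : (0 : ℝ) < s.card := by exact_mod_cast hne.card_pos
  calc log s.card ≤ log (((4 : ℝ) ^ n + 1) ^ (2 * (2 * K + 1))) := log_le_log hs0 hsc
    _ = 2 * (2 * K + 1) * log ((4 : ℝ) ^ n + 1) := by
      rw [log_pow]
      push_cast
      ring
    _ ≤ 2 * (16 * n / H + 3) * (2 * n) := by
      have := (log_le_log (by positivity) (four_pow_add_one_le h4)).trans_eq (log_exp _)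
      have h0 : 0 ≤ log ((4 : ℝ) ^ n + 1) := log_nonneg (by
        have : (0 : ℝ) < 4 ^ n := by positivity
        linarith)
      gcongr
    _ = 64 / H * n ^ 2 + 12 * n := by ring
    _ ≤ 64 / H * n ^ 2 + 4 / H * n ^ 2 := by
      have : 4 / H * (n : ℝ) ^ 2 = 4 * n * n / H := by ring
      rw [this]
      have : 12 * (n : ℝ) ≤ 4 * n * n / H := by
        rw [le_div_iff₀ hH]
        have : (0 : ℝ) ≤ n := Nat.cast_nonneg _
        nlinarith
      linarith
    _ = _ := by ring

/-! ### Approximation of `A_h` from `A_H` and the regret bound -/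

theorem openStrip_subset {D : Set ℂ} {H : ℝ} (hD : D = openStrip H ∨ D = closedStrip H) :
    openStrip H ⊆ D := by
  rcases hD with rfl | rfl
  · exact subset_rfl
  · exact fun z hz => le_of_lt (α := ℝ) hz

theorem subset_closedStrip {D : Set ℂ} {H : ℝ} (hD : D = openStrip H ∨ D = closedStrip H) :
    D ⊆ closedStrip H := by
  rcases hD with rfl | rfl
  · exact fun z hz => le_of_lt (α := ℝ) hz
  · exact subset_rfl

/-- Approximation of a function of `A_h` by an element of a net for a ball of `A_H`. -/
theorem eventually_exists_dist_net_le {D : Set ℂ} {H h R : ℝ} (hH : 0 < H) (hh : 0 < h)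
    (hR : 1 ≤ R) (hD : D ⊆ closedStrip H) {F : C(Signal, ℝ)}
    (hF : ∀ n, ‖fourierCoeff (complexify F) n‖ ≤ R * rexp (-(|(n : ℝ)| * (h / 2)))) :
    ∀ᶠ N : ℕ in Filter.atTop, ∀ net, IsNetSystem D net →
      ∀ i j : ℕ, (4 * H / h + 1) * logb 2 N ≤ i → logb 2 N ≤ j →
        ∃ g ∈ net i j, dist F g ≤ (R * tailConst (h / 2) + 1) / N := by
  have e1 : ∀ᶠ N : ℕ in Filter.atTop, (8 * log N / h + 3) * (R * rexp H) ≤ N := by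
    have hc : 0 < ((8 / h + 3) * (R * rexp H))⁻¹ := by positivity
    filter_upwards [(isLittleO_log_id_atTop.comp_tendsto
      (tendsto_natCast_atTop_atTop (R := ℝ))).bound hc,
      (tendsto_log_atTop.comp (tendsto_natCast_atTop_atTop (R := ℝ))).eventually_ge_atTop 1]
      with N hN h1
    simp only [Function.comp_apply, id] at hN h1
    rw [Real.norm_of_nonneg (by linarith), Real.norm_of_nonneg (Nat.cast_nonneg _),
      inv_mul_eq_div, le_div_iff₀ (by positivity)] at hN
    refine le_trans ?_ hN
    rw [← mul_assoc (log N)]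
    have : log N * (8 / h + 3) = 8 * log N / h + 3 * log N := by ring
    gcongr
    linarith
  filter_upwards [e1, Filter.eventually_ge_atTop 1] with N hN hN1 net hnet i j hi hj
  have hN0 : (0 : ℝ) < N := by exact_mod_cast hN1
  have hlog : 0 ≤ log N := log_nonneg (by exact_mod_cast hN1)
  have hlogb : logb 2 N * log 2 = log N := by
    rw [logb, div_mul_cancel₀ _ (log_pos one_lt_two).ne']
  -- The tail is of order `exp (-m h / 4)`, so this degree makes it `O(1 / N)`.
  set m := ⌈4 * log N / h⌉₊
  have hm1 : 4 * log N / h ≤ m := Nat.le_ceil _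
  have hm2 : (m : ℝ) < 4 * log N / h + 1 := Nat.ceil_lt_add_one (by positivity)
  have hpow : ∀ (k : ℕ) (b : ℝ), b * logb 2 N ≤ k → rexp (b * log N) ≤ 2 ^ k := fun k b hb => by
    have h2 : (2 : ℝ) ^ k = rexp (k * log 2) := by rw [exp_nat_mul, exp_log two_pos]
    rw [h2, ← hlogb, ← mul_assoc]
    exact exp_le_exp.2 (mul_le_mul_of_nonneg_right hb (log_nonneg one_le_two))
  have hcoef : ∀ n, ‖fourierCoeff (complexify F) n‖ ≤ R := fun n =>
    (hF n).trans (mul_le_of_le_one_right (by linarith)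
      (exp_le_one_iff.2 (neg_nonpos.2 (by positivity))))
  -- The extra power of `N` in the radius absorbs `(8 log N / h + 3) R exp H`, so that the constants
  -- depending on `F` affect only the threshold.
  have hball : (2 * m + 1) * (R * rexp (m * H)) ≤ 2 ^ (i + 1) := by
    calc (2 * m + 1) * (R * rexp (m * H))
        ≤ (8 * log N / h + 3) * (R * rexp ((4 * log N / h + 1) * H)) := by
          have : (2 * m + 1 : ℝ) ≤ 8 * log N / h + 3 := by
            have : 8 * log N / h = 2 * (4 * log N / h) := by ring
            linarith
          gcongr
      _ = (8 * log N / h + 3) * (R * rexp H) * rexp (4 * H / h * log N) := by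
          rw [show (4 * log N / h + 1) * H = H + 4 * H / h * log N by ring, exp_add]
          ring
      _ ≤ N * rexp (4 * H / h * log N) := by gcongr
      _ = rexp ((4 * H / h + 1) * log N) := by
          rw [add_mul, one_mul, exp_add, exp_log hN0, mul_comm]
      _ ≤ 2 ^ i := hpow i _ hi
      _ ≤ 2 ^ (i + 1) := pow_le_pow_right₀ one_le_two (Nat.le_succ i)
  have hmem := analyticBall_mono hball (trigPoly_mem_analyticBall hD m hcoef)
  obtain ⟨g, hg, hdist⟩ := (hnet i j).1.2 _ hmem
  refine ⟨g, hg, (dist_triangle F (trigPoly m (fourierCoeff (complexify F))) g).trans ?_⟩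
  rw [add_div]
  refine add_le_add ((dist_trigPoly_le (by linarith) hF m).trans ?_) (hdist.trans ?_)
  · have hB := tailConst_nonneg (h / 2)
    rw [div_eq_mul_inv (R * tailConst (h / 2))]
    refine mul_le_mul_of_nonneg_left ?_ (by positivity)
    rw [← exp_log hN0, ← exp_neg]
    refine exp_le_exp.2 (neg_le_neg ?_)
    rw [div_le_iff₀ hh] at hm1
    linarith
  · have h1 := hpow j 1 (by rwa [one_mul])
    rw [one_mul, exp_log hN0] at h1
    rw [one_div, inv_pow, one_div]
    exact inv_anti₀ hN0 (h1.trans (pow_le_pow_right₀ one_le_two (Nat.le_succ j)))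

theorem log_add_one_le (n : ℕ) : log ((n : ℝ) + 1) ≤ n := by
  have := log_le_sub_one_of_pos (x := (n : ℝ) + 1) (by positivity)
  linarith

theorem log_pi_sq_div_six_le : log (π ^ 2 / 6) ≤ 2 := by
  have := log_le_sub_one_of_pos (x := π ^ 2 / 6) (by positivity)
  nlinarith [pi_le_four, pi_pos]

theorem eventually_loss_banachStrategy_le {D : Set ℂ} {H h : ℝ} (hH : 0 < H) (hh : 0 < h)
    (hhH : h < H) (hD1 : openStrip H ⊆ D) (hD2 : D ⊆ closedStrip H) {F : C(Signal, ℝ)}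
    (hF : F ∈ analyticClass (openStrip h)) :
    ∀ᶠ N : ℕ in Filter.atTop, ∀ net, IsNetSystem D net →
      ∀ (x : ℕ → Signal) (y : ℕ → ℝ), (∀ n, y n ∈ Set.Icc (-1 : ℝ) 1) →
        Strategy.loss (banachStrategy net) (history x y N) ≤
          ∑ n ∈ Finset.range N, (y n - F (x n)) ^ 2 + 30000 * (H / h ^ 2) * logb 2 N ^ 2 := by
  obtain ⟨f, hf, R₀, hR₀⟩ := hF
  obtain ⟨R, hR0, hR1⟩ : ∃ R, R₀ ≤ R ∧ 1 ≤ R := ⟨max R₀ 1, le_max_left _ _, le_max_right _ _⟩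
  have hcoef := norm_fourierCoeff_le_of_mem_analyticBall hh subset_rfl (R := R) (F := F)
    ⟨f, hf, fun z hz => (hR₀ z hz).trans hR0⟩
  set A := R * tailConst (h / 2) + 1
  obtain ⟨n₀, hn₀⟩ := eventually_entropy_le hH hD1
  have hL : Filter.Tendsto (fun N : ℕ => logb 2 N) Filter.atTop Filter.atTop :=
    (tendsto_logb_atTop one_lt_two).comp tendsto_natCast_atTop_atTop
  filter_upwards [eventually_exists_dist_net_le hH hh hR1 hD2 hcoef, hL.eventually_ge_atTop 4,
    hL.eventually_ge_atTop n₀, hL.eventually_ge_atTop (14 * h),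
    hL.eventually_ge_atTop ((4 * A + 32) / (H / h ^ 2)), Filter.eventually_ge_atTop 1]
    with N hdist hL4 hLn₀ hLh hLA hN1 net hnet x y hy
  have hN0 : (0 : ℝ) < N := by exact_mod_cast hN1
  set L := logb 2 N
  set i := ⌈(4 * H / h + 1) * L⌉₊
  set j := ⌈L⌉₊
  have hi1 : (4 * H / h + 1) * L ≤ i := Nat.le_ceil _
  have hi2 : (i : ℝ) < (4 * H / h + 1) * L + 1 := Nat.ceil_lt_add_one (by positivity)
  have hj1 : L ≤ j := Nat.le_ceil _
  have hj2 : (j : ℝ) < L + 1 := Nat.ceil_lt_add_one (by positivity)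
  obtain ⟨g, hg, hFg⟩ := hdist net hnet i j hi1 hj1
  have hreg := loss_banachStrategy_le hnet.nonempty (admissibleHistory_history (x := x) hy N)
    i j hg
  have hclip := loss_clippedRule_le (F := F) (g := g)
    (fun t => (ContinuousMap.dist_apply_le_dist t).trans hFg) (x := x) hy N
  have hAN : N * (4 * (A / N)) = 4 * A := by field_simp
  rw [hAN] at hclip
  -- The sum is at most `4 (H / h) L + 2L + 4`; now `4 ≤ L` and `1 ≤ H / h`.
  have hn : ((i + 1 + (j + 1) : ℕ) : ℝ) ≤ 7 * (H / h * L) := by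
    push_cast
    have hHh : 1 ≤ H / h := (one_le_div hh).2 hhH.le
    have : (4 * H / h + 1) * L = 4 * (H / h * L) + L := by ring
    nlinarith
  have hent := hn₀ (i + 1) (j + 1) (by
    have : n₀ ≤ j := by exact_mod_cast hLn₀.trans hj1
    omega) (net i j) (hnet.nonempty i j) (hnet i j)
  have hcard : log (net i j).card ≤ 3332 * (H / h ^ 2 * L ^ 2) := by
    refine hent.trans ?_
    calc 68 / H * ((i + 1 + (j + 1) : ℕ) : ℝ) ^ 2 ≤ 68 / H * (7 * (H / h * L)) ^ 2 := by gcongr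
      _ = _ := by field_simp; ring
  -- The logarithms of the weights of `i` and `j` are bounded crudely by `i` and `j`, thus are
  -- linear in `L` and absorbed by `L²`.
  have hHL : 14 * (H / h * L) ≤ H / h ^ 2 * L ^ 2 := by
    have : H / h ^ 2 * L ^ 2 = H / h * L * (L / h) := by field_simp
    rw [this, mul_comm 14]
    have h14 : 14 ≤ L / h := (le_div_iff₀ hh).2 hLh
    gcongr
  have hconst : 4 * A + 32 ≤ H / h ^ 2 * L ^ 2 := by
    rw [div_le_iff₀ (by positivity)] at hLA
    have : 0 ≤ H / h ^ 2 := by positivity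
    nlinarith [mul_nonneg this (by nlinarith : 0 ≤ L ^ 2 - L)]
  have hlogi := log_add_one_le i
  have hlogj := log_add_one_le j
  have hπ := log_pi_sq_div_six_le
  push_cast at hn
  have : 0 ≤ H / h ^ 2 * L ^ 2 := by positivity
  rw [mul_assoc 30000]
  -- The coefficients add up to `8 * 3332 + 8 + 1`, below 30000: entropy, weights of `i` and `j`,
  -- and remaining constants.
  linarith

end OnlineRegression

theorem corollary10 :
    ∃ C : ℝ, 0 < C ∧ ∀ H : ℝ, 0 < H → ∀ D : Set ℂ,
      D = OnlineRegression.openStrip H ∨ D = OnlineRegression.closedStrip H →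
      (∃ S, OnlineRegression.IsStrategyFor D S) ∧
      ∀ S : OnlineRegression.Strategy OnlineRegression.Signal,
        OnlineRegression.IsStrategyFor D S →
        ∀ h : ℝ, 0 < h → h < H →
        ∀ F ∈ OnlineRegression.analyticClass (OnlineRegression.openStrip h),
          ∃ N₀ : ℕ, ∀ N : ℕ, N₀ ≤ N →
            ∀ (x : ℕ → OnlineRegression.Signal) (y : ℕ → ℝ), (∀ n, y n ∈ Set.Icc (-1 : ℝ) 1) →
              ∑ n ∈ Finset.range N, (y n - S.prediction x y n) ^ 2 ≤
                ∑ n ∈ Finset.range N, (y n - F (x n)) ^ 2 +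
                  C * (H ^ 2 / h ^ 3) * Real.logb 2 N ^ 2 := by
  refine ⟨30000, by norm_num, fun H hH D hD => ⟨?_, ?_⟩⟩
  · obtain ⟨net, hnet⟩ :=
      OnlineRegression.exists_isNetSystem hH (OnlineRegression.openStrip_subset hD)
    exact ⟨_, net, hnet, rfl⟩
  · rintro S ⟨net, hnet, rfl⟩ h hh hhH F hF
    obtain ⟨N₀, hN₀⟩ := Filter.eventually_atTop.1
      (OnlineRegression.eventually_loss_banachStrategy_le hH hh hhH
        (OnlineRegression.openStrip_subset hD) (OnlineRegression.subset_closedStrip hD) hF)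
    refine ⟨N₀, fun N hN x y hy => ?_⟩
    rw [← OnlineRegression.Strategy.loss_history]
    refine (hN₀ N hN net hnet x y hy).trans ?_
    -- The bound already proved is stronger by the factor `H / h > 1`.
    have : H / h ^ 2 ≤ H ^ 2 / h ^ 3 := by
      rw [div_le_div_iff₀ (by positivity) (by positivity)]
      have : H * h ^ 2 * h ≤ H * h ^ 2 * H := by gcongr
      nlinarith
    gcongr
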